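/- Let $G$ be a group with a finite generating set $S$, and let $X=\mathrm{Cay}(G,S)$ be its unlabelled Cayley graph, with vertex set $G$ and an edge between $g$ and $gs$ for all $g\in G$ and $s\in S\cup S^{-1}$. Regard $G$ as a subgroup of the automorphism group $\mathrm{Aut}(X)$ through left multiplication, let $$\mathrm{Comm}_{\mathrm{Aut}(X)}(G)=\{\gamma\in \mathrm{Aut}(X) : [G:G\cap\gamma G\gamma^{-1}]<\infty \text{ and } [\gamma G\gamma^{-1}:G\cap\gamma G\gamma^{-1}]<\infty\}$$ be its commensurator, let $\mathcal{C}_1^X(G)$ be the stabiliser of the vertex $1$ in $\mathrm{Comm}_{\mathrm{Aut}(X)}(G)$, and let $D_G$ be the largest subgroup of $G$ that is normalised by $\mathrm{Comm}_{\mathrm{Aut}(X)}(G)$. A Mealy automaton consists of finite sets $A$ (the alphabet) and $Q$ (the states) and maps $\lambda\colon Q\times A\to A$ and $\rho\colon Q\times A\to Q$. It is bireversible if all the maps $\lambda(q,\cdot)\colon A\to A$ ($q\in Q$) and $\rho(\cdot,a)\colon Q\to Q$ ($a\in A$), as well as the map $Q\times A\to A\times Q$, $(q,a)\mapsto(\lambda(q,a),\rho(q,a))$,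 are bijections. Every state $q$ then defines a bijection $\lambda_q$ of the set $A^*$ of finite words over $A$, by $\lambda_q(\varnothing)=\varnothing$ and $\lambda_q(aw)=\lambda(q,a)\,\lambda_{\rho(q,a)}(w)$; the group generated by the automaton is the quotient of the free group on $Q$ by the kernel of the homomorphism $q\mapsto\lambda_q$ to the group of bijections of $A^*$. A group is called bireversible if it is isomorphic to the group generated by some bireversible Mealy automaton. Suppose that $\mathcal{C}_1^X(G)$ is not locally finite, i.e. that it has an infinite finitely generated subgroup. Then $G/D_G$ is residually infinite bireversible: for every $g\in G\setminus D_G$ there is a normal subgroup $N$ of $G$ with $D_G\le N$ and $g\notin N$ such that $G/N$ is an infinite bireversible group. More precisely, there is a sequence $N_1\ge N_2\ge\cdots$ of normal subgroups of $G$ such that every $G/N_i$ is an infinite bireversible group and $\bigcap_{i\ge 1}N_i=D_G$. -/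

import Mathlib

/-- A Mealy automaton with alphabet `A` and state set `Q` (finiteness of `A` and `Q` is required
where automata are used): `out` is the output map `Q × A → A` and `next` is the transition map
`Q × A → Q`. -/
structure MealyAutomaton (A Q : Type*) where
  /-- The output map. -/
  out : Q → A → A
  /-- The transition map. -/
  next : Q → A → Q

namespace MealyAutomaton

variable {A Q : Type*} (M : MealyAutomaton A Q)

/-- Every state induces a bijection of the alphabet. -/
def Invertible : Prop := ∀ q : Q, Function.Bijective fun a : A => M.out q a

/-- Every letter induces a bijection of the state set. -/
def Reversible : Prop := ∀ a : A, Function.Bijective fun q : Q => M.next q a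

/-- Invertible, reversible, and `(q, a) ↦ (out q a, next q a)` is a bijection `Q × A → A × Q`. -/
def Bireversible : Prop :=
  M.Invertible ∧ M.Reversible ∧
    Function.Bijective fun p : Q × A => ((M.out p.1 p.2, M.next p.1 p.2) : A × Q)

/-- The transformation of the set `A*` of finite words over `A` defined by the state `q`. -/
def act : Q → List A → List A
  | _, [] => []
  | q, a :: w => M.out q a :: act (M.next q a) w

theorem act_bijective (h : M.Invertible) (q : Q) : Function.Bijective (M.act q) := by
  constructor
  · intro v w hvw
    induction v generalizing q w with
    | nil => cases w with
      | nil => rfl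
      | cons b w => simp [act] at hvw
    | cons a v ih => cases w with
      | nil => simp [act] at hvw
      | cons b w =>
        simp only [act, List.cons.injEq] at hvw
        obtain rfl : a = b := (h q).1 hvw.1
        rw [ih _ hvw.2]
  · intro w
    induction w generalizing q with
    | nil => exact ⟨[], rfl⟩
    | cons b w ih =>
      obtain ⟨a, rfl⟩ := (h q).2 b
      obtain ⟨v, rfl⟩ := ih (M.next q a)
      exact ⟨a :: v, rfl⟩

/-- The homomorphism from the free group on the states of an invertible automaton to the group of
all bijections of `A*` that sends every state to the bijection it defines. -/
noncomputable def freeGroupAction (h : M.Invertible) : FreeGroup Q →* Equiv.Perm (List A) :=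
  FreeGroup.lift fun q => Equiv.ofBijective (M.act q) (M.act_bijective h q)

/-- The group generated by an invertible automaton. -/
abbrev AutomatonGroup (h : M.Invertible) : Type _ := FreeGroup Q ⧸ (M.freeGroupAction h).ker

end MealyAutomaton

/-- A group is bireversible if it is isomorphic to the group generated by some bireversible
(finite) Mealy automaton. -/
def IsBireversibleGroup (H : Type*) [Group H] : Prop :=
  ∃ (A Q : Type) (_ : Finite A) (_ : Finite Q) (M : MealyAutomaton A Q) (hM : M.Bireversible),
    Nonempty (H ≃* M.AutomatonGroup hM.1)

/-- A group is locally finite if each of its finitely generated subgroups is finite. -/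
def IsLocallyFiniteGroup (H : Type*) [Group H] : Prop :=
  ∀ K : Subgroup H, K.FG → Finite K

namespace CayleyGraph

variable {G : Type*} [Group G] (S : Set G)

/-- The automorphism group of the (unlabelled) Cayley graph of `G` with respect to `S`, in which
`g` and `g * s` are joined by an edge for all `g` in `G` and all `s` in `S`. -/
abbrev Aut : Type _ := SimpleGraph.mulCayley S ≃g SimpleGraph.mulCayley S

/-- The embedding of `G` into the automorphism group of its Cayley graph, by left
multiplication. -/
def leftMul : G →* Aut S where
  toFun g :=
    { toEquiv := Equiv.mulLeft g
      map_rel_iff' := by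
        intro a b
        simp [SimpleGraph.mulCayley_adj', mul_assoc] }
  map_one' := by ext x; simp
  map_mul' g h := by ext x; simp

/-- The commensurator of `G` (acting by left multiplication) in the automorphism group of its
Cayley graph. -/
def comm : Subgroup (Aut S) := Subgroup.Commensurable.commensurator (leftMul S).range

/-- The subgroup of the elements of the commensurator that fix the vertex `1`. -/
def commStab : Subgroup (Aut S) := comm S ⊓ MulAction.stabilizer (Aut S) (1 : G)

/-- `D` is normalised by the commensurator of `G` in the automorphism group of its Cayley graph. -/
def IsNormalisedByComm (D : Subgroup G) : Prop :=
  comm S ≤ Subgroup.normalizer (D.map (leftMul S) : Set (Aut S))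

/-- The largest subgroup of `G` that is normalised by the commensurator of `G` in the automorphism
group of its Cayley graph. -/
def largestNormalised : Subgroup G := sSup {D : Subgroup G | IsNormalisedByComm S D}

theorem isGreatest_largestNormalised :
    IsGreatest {D : Subgroup G | IsNormalisedByComm S D} (largestNormalised S) := by
  refine ⟨?_, fun D hD => le_sSup hD⟩
  intro c hc
  rw [Subgroup.mem_normalizer_iff_map_conj_eq, largestNormalised, sSup_eq_iSup]
  simp only [Subgroup.map_iSup]
  refine iSup_congr fun D => iSup_congr fun hD => ?_
  exact Subgroup.mem_normalizer_iff_map_conj_eq.1 (hD hc)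

end CayleyGraph

/-! An automorphism `c` fixing `1` satisfies `c (g * x) = c g * res c g x`, where the restriction
`res c g` again fixes `1`. If `c` commensurates `G`, it has only finitely many restrictions
(`finite_range_res`). So finitely many elements of the vertex stabiliser lie in a finite set `Q`
closed under restrictions and inverses. Through these squares `G` acts on words over `Q`, the
neighbours of `1` acting as the states of a finite bireversible automaton.

The kernel consists of the `g` with `res c g = c` for all `c` in the group generated by `Q`
(`mem_ker_wordAction`), that is, those `g` which every such `c` conjugates into `G`. It therefore
contains `D_G`, and its index is infinite when `Q` generates an infinite group. With the whole
stabiliser in place of `Q`, the kernel is normalised by the commensurator, hence lies in `D_G`.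
Enlarging `Q` step by step, from a finite set generating an infinite group, gives the sequence. -/

namespace MealyAutomaton

/-! ### Renaming, and recognising bireversible groups -/

variable {A Q : Type*} (M : MealyAutomaton A Q)

/-- The automaton obtained by renaming the letters along `e` and the states along `f`. -/
def rename {A' Q' : Type*} (e : A ≃ A') (f : Q ≃ Q') : MealyAutomaton A' Q' where
  out q a := e (M.out (f.symm q) (e.symm a))
  next q a := f (M.next (f.symm q) (e.symm a))

variable {M} in
theorem Bireversible.rename (h : M.Bireversible) {A' Q' : Type*} (e : A ≃ A') (f : Q ≃ Q') :
    (M.rename e f).Bireversible := by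
  refine ⟨fun q => ?_, fun a => ?_, ?_⟩
  · exact e.bijective.comp ((h.1 (f.symm q)).comp e.symm.bijective)
  · exact f.bijective.comp ((h.2.1 (e.symm a)).comp f.symm.bijective)
  · exact (e.prodCongr f).bijective.comp (h.2.2.comp (f.prodCongr e).symm.bijective)

theorem act_rename {A' Q' : Type*} (e : A ≃ A') (f : Q ≃ Q') (q : Q') (w : List A') :
    (M.rename e f).act q w = (M.act (f.symm q) (w.map e.symm)).map e := by
  induction w generalizing q with
  | nil => rfl
  | cons a w ih =>
    simp only [act, ih, List.map_cons, List.cons.injEq]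
    simp [MealyAutomaton.rename]

/-- If a group acts on words in such a way that a generating family acts like the states of a
bireversible automaton, then the group modulo the kernel of the action is bireversible. -/
theorem Bireversible.isBireversibleGroup_quotient_ker [Finite A] [Finite Q] {H : Type*} [Group H]
    {M : MealyAutomaton A Q} (hM : M.Bireversible) (φ : H →* Equiv.Perm (List A)) (σ : Q → H)
    (hσ : Subgroup.closure (Set.range σ) = ⊤) (hφ : ∀ q w, φ (σ q) w = M.act q w) :
    IsBireversibleGroup (H ⧸ φ.ker) := by
  -- `IsBireversibleGroup` asks for an automaton in `Type`, while `A` and `Q` may live in any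
  -- universe.
  obtain ⟨m, ⟨e⟩⟩ := Finite.exists_equiv_fin A
  obtain ⟨n, ⟨f⟩⟩ := Finite.exists_equiv_fin Q
  have hM' := hM.rename e f
  refine ⟨Fin m, Fin n, inferInstance, inferInstance, M.rename e f, hM', ?_⟩
  let ψ : H →* Equiv.Perm (List (Fin m)) :=
    (Equiv.permCongrHom (Equiv.listEquivOfEquiv e)).toMonoidHom.comp φ
  have hker : φ.ker = ψ.ker := by
    ext h
    simp [ψ, MonoidHom.mem_ker]
  have hψ : (M.rename e f).freeGroupAction hM'.1
      = ψ.comp (FreeGroup.lift fun q => σ (f.symm q)) := by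
    ext q w : 2
    simp only [freeGroupAction, FreeGroup.lift_apply_of, Equiv.ofBijective_apply, act_rename,
      MonoidHom.comp_apply]
    rw [← hφ]
    rfl
  have hrange : ψ.range = ((M.rename e f).freeGroupAction hM'.1).range := by
    have : Set.range (fun q => σ (f.symm q)) = Set.range σ := f.symm.surjective.range_comp σ
    rw [hψ, MonoidHom.range_comp ψ, FreeGroup.range_lift_eq_closure, this, hσ,
      ← MonoidHom.range_eq_map]
  exact ⟨(QuotientGroup.quotientMulEquivOfEq hker).trans
    ((QuotientGroup.quotientKerEquivRange ψ).trans ((MulEquiv.subgroupCongr hrange).trans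
      (QuotientGroup.quotientKerEquivRange _).symm))⟩

end MealyAutomaton

/-! ### Restrictions of automorphisms -/

namespace CayleyGraph

open scoped Pointwise

variable {G : Type*} [Group G] {S : Set G}

@[simp]
theorem leftMul_apply (g x : G) : leftMul S g x = g * x := rfl

theorem mul_apply (c d : Aut S) (x : G) : (c * d) x = c (d x) := rfl

/-- The restriction of `c` at the vertex `g`: the automorphism `x ↦ (c g)⁻¹ * c (g * x)`, which
fixes the vertex `1`. -/
def res (c : Aut S) (g : G) : Aut S := (leftMul S (c g))⁻¹ * c * leftMul S g

theorem res_apply (c : Aut S) (g x : G) : res c g x = (c g)⁻¹ * c (g * x) := by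
  rw [res, ← map_inv]
  rfl

theorem res_apply_one (c : Aut S) (g : G) : res c g 1 = 1 := by simp [res_apply]

theorem res_one {c : Aut S} (hc : c 1 = 1) : res c 1 = c := by
  ext x
  simp [res_apply, hc]

theorem apply_mul (c : Aut S) (g h : G) : c (g * h) = c g * res c g h := by
  simp [res_apply]

theorem res_mul (c : Aut S) (g h : G) : res c (g * h) = res (res c g) h := by
  ext x
  simp [res_apply, mul_assoc]

theorem mul_res (c d : Aut S) (g : G) : res (c * d) g = res c (d g) * res d g := by
  ext x
  simp [res_apply, mul_apply]

theorem inv_res (c : Aut S) (g : G) : (res c g)⁻¹ = res c⁻¹ (c g) := by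
  simp [res, mul_assoc]

/-- Restricting at `g⁻¹` undoes restricting at `g`. -/
theorem res_injective {c d : Aut S} (hc : c 1 = 1) (hd : d 1 = 1) {g : G}
    (h : res c g = res d g) : c = d := by
  have key : ∀ c : Aut S, c 1 = 1 → res (res c g) g⁻¹ = c := fun c hc => by
    rw [← res_mul, mul_inv_cancel, res_one hc]
  rw [← key c hc, h, key d hd]

/-- Rests on `c * leftMul S g = leftMul S (c g) * res c g`; it translates commensuration into
statements about restrictions. -/
theorem res_eq_self_iff {c : Aut S} (hc : c 1 = 1) (g : G) :
    res c g = c ↔ c * leftMul S g * c⁻¹ ∈ (leftMul S).range := by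
  constructor
  · intro h
    refine ⟨c g, ?_⟩
    nth_rw 3 [← h]
    simp [res, mul_assoc]
  · rintro ⟨k, hk⟩
    have hk' : leftMul S k * c = c * leftMul S g := by rw [hk]; group
    have : k = c g := by simpa [mul_apply, hc] using DFunLike.congr_fun hk' 1
    subst this
    rw [res, mul_assoc, ← hk']
    group

theorem leftMul_mem_comm (g : G) : leftMul S g ∈ comm S := by
  have : ConjAct.toConjAct (leftMul S g) • (leftMul S).range = (leftMul S).range :=
    Subgroup.ext fun x => by
      have hg : leftMul S g ∈ (leftMul S).range := ⟨g, rfl⟩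
      rw [Subgroup.mem_pointwise_smul_iff_inv_smul_mem, ← ConjAct.toConjAct_inv, ConjAct.smul_def,
        ConjAct.ofConjAct_toConjAct, Subgroup.mul_mem_cancel_right _ (inv_mem (inv_mem hg)),
        Subgroup.mul_mem_cancel_left _ (inv_mem hg)]
  rw [comm, Subgroup.Commensurable.commensurator_mem_iff, this]

theorem mem_commStab {c : Aut S} : c ∈ commStab S ↔ c ∈ comm S ∧ c 1 = 1 := Iff.rfl

theorem res_mem_commStab {c : Aut S} (hc : c ∈ comm S) (g : G) : res c g ∈ commStab S :=
  mem_commStab.2 ⟨mul_mem (mul_mem (inv_mem (leftMul_mem_comm _)) hc) (leftMul_mem_comm _),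
    res_apply_one c g⟩

/-- The elements of `G` that `c` conjugates into `G` form a subgroup `H` of finite index, and `res c
(h * g) = res c g` for `h` in `H`. -/
theorem finite_range_res {c : Aut S} (hc : c ∈ commStab S) : (Set.range (res c)).Finite := by
  let H : Subgroup G :=
    (ConjAct.toConjAct c⁻¹ • (leftMul S).range : Subgroup (Aut S)).comap (leftMul S)
  have hH : ∀ h ∈ H, res c h = c := by
    intro h hh
    rw [res_eq_self_iff hc.2]
    have := (Subgroup.mem_pointwise_smul_iff_inv_smul_mem).1 (Subgroup.mem_comap.1 hh)
    simpa [ConjAct.smul_def] using this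
  have : H.FiniteIndex := ⟨by
    rw [Subgroup.index_comap]
    exact ((Subgroup.Commensurable.commensurator_mem_iff _ _).1 (inv_mem hc.1)).1⟩
  -- `res c` is constant on the cosets `H g`, but `G ⧸ H` consists of the cosets `g H`, hence the
  -- inverses.
  refine (Set.finite_range fun x : G ⧸ H => res c x.out⁻¹).subset ?_
  rintro _ ⟨g, rfl⟩
  obtain ⟨h, hh⟩ := QuotientGroup.mk_out_eq_mul H g⁻¹
  refine ⟨(g⁻¹ : G), ?_⟩
  simp only [hh, mul_inv_rev, inv_inv]
  rw [res_mul, hH _ (inv_mem h.2)]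

/-! ### Self-similar sets -/

/-- A set of automorphisms fixing `1` that is closed under restrictions and inverses. -/
structure IsSelfSimilar (Q : Set (Aut S)) : Prop where
  apply_one : ∀ c ∈ Q, c 1 = 1
  res_mem : ∀ c ∈ Q, ∀ g, res c g ∈ Q
  inv_mem : ∀ c ∈ Q, c⁻¹ ∈ Q

/-- The set of all restrictions of elements of `T` and of their inverses. -/
def selfSimilarHull (T : Set (Aut S)) : Set (Aut S) :=
  ⋃ c ∈ T ∪ T⁻¹, Set.range (res c)

theorem mem_selfSimilarHull {T : Set (Aut S)} {d : Aut S} :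
    d ∈ selfSimilarHull T ↔ ∃ c, (c ∈ T ∨ c⁻¹ ∈ T) ∧ ∃ g, res c g = d := by
  simp [selfSimilarHull]

theorem isSelfSimilar_selfSimilarHull (T : Set (Aut S)) : IsSelfSimilar (selfSimilarHull T) where
  apply_one := by
    intro d hd
    obtain ⟨c, -, g, rfl⟩ := mem_selfSimilarHull.1 hd
    exact res_apply_one c g
  res_mem := by
    intro d hd h
    obtain ⟨c, hc, g, rfl⟩ := mem_selfSimilarHull.1 hd
    exact mem_selfSimilarHull.2 ⟨c, hc, g * h, res_mul c g h⟩
  inv_mem := by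
    intro d hd
    obtain ⟨c, hc, g, rfl⟩ := mem_selfSimilarHull.1 hd
    exact mem_selfSimilarHull.2 ⟨c⁻¹, by rwa [inv_inv, or_comm], c g, (inv_res c g).symm⟩

theorem selfSimilarHull_mono {T T' : Set (Aut S)} (h : T ⊆ T') :
    selfSimilarHull T ⊆ selfSimilarHull T' :=
  Set.biUnion_subset_biUnion_left (Set.union_subset_union h (Set.inv_subset_inv.2 h))

theorem subset_selfSimilarHull {T : Set (Aut S)} (hT : T ⊆ commStab S) :
    T ⊆ selfSimilarHull T := fun c hc =>
  mem_selfSimilarHull.2 ⟨c, Or.inl hc, 1, res_one (hT hc).2⟩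

theorem selfSimilarHull_subset {T : Set (Aut S)} (hT : T ⊆ commStab S) :
    selfSimilarHull T ⊆ commStab S := by
  intro d hd
  obtain ⟨c, hc, g, rfl⟩ := mem_selfSimilarHull.1 hd
  refine res_mem_commStab (mem_commStab.1 ?_).1 g
  exact hc.elim (fun h => hT h) fun h => inv_mem_iff.1 (hT h)

theorem finite_selfSimilarHull {T : Set (Aut S)} (hfin : T.Finite) (hT : T ⊆ commStab S) :
    (selfSimilarHull T).Finite := by
  refine (hfin.union hfin.inv).biUnion fun c hc => finite_range_res ?_
  exact hc.elim (fun h => hT h) fun h => inv_mem_iff.1 (hT h)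

/-! ### The action of the group on words -/

/-- The automaton with alphabet `Q` and infinite state set `G` through which `G` acts on words
over a self-similar set `Q`. -/
def automaton {Q : Set (Aut S)} (hQ : IsSelfSimilar Q) : MealyAutomaton Q G where
  -- By `res_mul`, restriction is a right action; the inverses make it a left one.
  out g c := ⟨res c g⁻¹, hQ.res_mem c c.2 g⁻¹⟩
  next g c := ((c : Aut S) g⁻¹)⁻¹

section action

variable {Q : Set (Aut S)} (hQ : IsSelfSimilar Q)

theorem act_one (w : List Q) : (automaton hQ).act 1 w = w := by
  induction w with
  | nil => rfl
  | cons c w ih =>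
    have hc := hQ.apply_one c c.2
    simp [MealyAutomaton.act, automaton, hc, res_one hc] at ih ⊢
    exact ih

theorem act_mul (g h : G) (w : List Q) :
    (automaton hQ).act (g * h) w = (automaton hQ).act g ((automaton hQ).act h w) := by
  induction w generalizing g h with
  | nil => rfl
  | cons c w ih =>
    simp only [MealyAutomaton.act, automaton, List.cons.injEq, mul_inv_rev] at ih ⊢
    refine ⟨Subtype.ext (res_mul _ _ _), ?_⟩
    rw [apply_mul, mul_inv_rev, ih]

/-- The action of `G` on words over a self-similar set of automorphisms. -/
def wordAction : G →* Equiv.Perm (List Q) where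
  toFun g :=
    { toFun := (automaton hQ).act g
      invFun := (automaton hQ).act g⁻¹
      left_inv := fun w => by rw [← act_mul, inv_mul_cancel, act_one]
      right_inv := fun w => by rw [← act_mul, mul_inv_cancel, act_one] }
  map_one' := Equiv.ext (act_one hQ)
  map_mul' g h := Equiv.ext (act_mul hQ g h)

theorem wordAction_inv_cons (g : G) (c : Q) (w : List Q) :
    wordAction hQ g⁻¹ (c :: w) =
      ⟨res c g, hQ.res_mem c c.2 g⟩ :: wordAction hQ ((c : Aut S) g)⁻¹ w := by
  change (automaton hQ).act g⁻¹ (c :: w) = _ :: (automaton hQ).act _ w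
  simp [MealyAutomaton.act, automaton]

theorem apply_one_of_mem_closure (hQ : IsSelfSimilar Q) {c : Aut S}
    (hc : c ∈ Subgroup.closure Q) : c 1 = 1 := by
  have : Subgroup.closure Q ≤ MulAction.stabilizer (Aut S) (1 : G) :=
    (Subgroup.closure_le _).2 fun c hc => hQ.apply_one c hc
  exact this hc

/-- The kernel of the action on words consists of the elements at which every product of elements
of `Q` restricts to itself. -/
theorem mem_ker_wordAction {g : G} :
    g ∈ (wordAction hQ).ker ↔ ∀ c ∈ Subgroup.closure Q, res c g = c := by
  constructor
  -- The induction over products needs the stronger claim that `c` also maps the kernel to itself.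
  · have hmem : ∀ c ∈ Q, ∀ g ∈ (wordAction hQ).ker,
        res c g = c ∧ c g ∈ (wordAction hQ).ker := by
      intro c hc g hg
      have h : ∀ w, wordAction hQ g⁻¹ (⟨c, hc⟩ :: w) = ⟨c, hc⟩ :: w := fun w => by
        rw [MonoidHom.mem_ker.1 (inv_mem hg)]
        rfl
      simp only [wordAction_inv_cons, List.cons.injEq, Subtype.mk.injEq] at h
      exact ⟨(h []).1, inv_mem_iff.1 (MonoidHom.mem_ker.2 (Equiv.ext fun w => (h w).2))⟩
    suffices ∀ c ∈ Subgroup.closure Q, ∀ g ∈ (wordAction hQ).ker,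
        res c g = c ∧ c g ∈ (wordAction hQ).ker from fun hg c hc => (this c hc g hg).1
    intro c hc
    induction hc using Subgroup.closure_induction'' with
    | mem c hc => exact hmem c hc
    | inv_mem c hc => exact hmem _ (hQ.inv_mem c hc)
    | one => exact fun g hg => ⟨by ext x; simp [res_apply], hg⟩
    | mul c d _ _ ihc ihd =>
      intro g hg
      obtain ⟨h₁, h₂⟩ := ihd g hg
      obtain ⟨h₃, h₄⟩ := ihc _ h₂
      exact ⟨by rw [mul_res, h₁, h₃], h₄⟩
  · intro hg
    rw [← inv_mem_iff, MonoidHom.mem_ker]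
    ext1 w
    induction w generalizing g with
    | nil => rfl
    | cons c w ih =>
      have hc : (c : Aut S) ∈ Subgroup.closure Q := Subgroup.subset_closure c.2
      rw [wordAction_inv_cons, ih]
      · simp [hg c hc]
      -- Comparing the restrictions of `d * c` and `c` at `g` shows that `c g` inherits the
      -- hypothesis on `g`.
      · intro d hd
        have := hg _ (mul_mem hd hc)
        rwa [mul_res, hg c hc, mul_left_inj] at this

theorem ker_wordAction_anti {Q' : Set (Aut S)} (hQ' : IsSelfSimilar Q') (h : Q ⊆ Q') :
    (wordAction hQ').ker ≤ (wordAction hQ).ker := fun _ hg =>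
  (mem_ker_wordAction hQ).2 fun c hc =>
    (mem_ker_wordAction hQ').1 hg c (Subgroup.closure_mono h hc)

end action

/-! ### The finite bireversible automaton -/

variable (S) in
/-- The vertices adjacent to `1`. -/
def letters : Set G := {a | (SimpleGraph.mulCayley S).Adj 1 a}

theorem mem_letters {a : G} : a ∈ letters S ↔ a ≠ 1 ∧ (a ∈ S ∨ a⁻¹ ∈ S) := by
  rw [letters, Set.mem_ofPred_eq, SimpleGraph.mulCayley_adj']
  refine and_congr ne_comm ⟨?_, ?_⟩
  · rintro ⟨s, hs, h | h⟩
    · rw [one_mul] at h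
      exact Or.inl (h ▸ hs)
    · rw [← eq_inv_of_mul_eq_one_right h.symm] at *
      exact Or.inr hs
  · rintro (h | h)
    · exact ⟨a, h, Or.inl (one_mul a)⟩
    · exact ⟨a⁻¹, h, Or.inr (by simp)⟩

theorem finite_letters (hS : S.Finite) : (letters S).Finite :=
  (hS.union hS.inv).subset fun _ ha => (mem_letters.1 ha).2

theorem inv_mem_letters {a : G} (ha : a ∈ letters S) : a⁻¹ ∈ letters S := by
  simpa [mem_letters, or_comm] using ha

theorem closure_letters (hgen : Subgroup.closure S = ⊤) : Subgroup.closure (letters S) = ⊤ := by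
  rw [eq_top_iff, ← hgen, Subgroup.closure_le]
  intro s hs
  by_cases h : s = 1
  · exact h ▸ one_mem _
  · exact Subgroup.subset_closure (mem_letters.2 ⟨h, Or.inl hs⟩)

theorem apply_mem_letters {c : Aut S} (hc : c 1 = 1) {a : G} (ha : a ∈ letters S) :
    c a ∈ letters S := by
  have := c.map_rel_iff.2 ha
  rwa [hc] at this

/-- The automaton with alphabet `Q` whose states are the vertices adjacent to `1`. -/
def letterAutomaton {Q : Set (Aut S)} (hQ : IsSelfSimilar Q) : MealyAutomaton Q (letters S) where
  out a c := (automaton hQ).out a c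
  next a c := ⟨(automaton hQ).next a c,
    inv_mem_letters (apply_mem_letters (hQ.apply_one c c.2) (inv_mem_letters a.2))⟩

theorem act_letterAutomaton {Q : Set (Aut S)} (hQ : IsSelfSimilar Q) (a : letters S)
    (w : List Q) : (letterAutomaton hQ).act a w = (automaton hQ).act a w := by
  induction w generalizing a with
  | nil => rfl
  | cons c w ih => exact congrArg _ (ih _)

theorem bireversible_letterAutomaton (hS : S.Finite) {Q : Set (Aut S)} (hQ : IsSelfSimilar Q)
    (hfin : Q.Finite) : (letterAutomaton hQ).Bireversible := by
  have := hfin.to_subtype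
  have := (finite_letters hS).to_subtype
  refine ⟨fun a => Finite.injective_iff_bijective.1 fun c d h => ?_,
    fun c => Finite.injective_iff_bijective.1 fun a b h => ?_, ?_⟩
  · exact Subtype.ext (res_injective (hQ.apply_one c c.2) (hQ.apply_one d d.2)
      (Subtype.ext_iff.1 h))
  · have h' : ((c : Aut S) (a : G)⁻¹)⁻¹ = ((c : Aut S) (b : G)⁻¹)⁻¹ := Subtype.ext_iff.1 h
    exact Subtype.ext (inv_injective ((c : Aut S).injective (inv_injective h')))
  · have hinj : Function.Injective fun p : letters S × Q =>
        ((letterAutomaton hQ).out p.1 p.2, (letterAutomaton hQ).next p.1 p.2) := by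
      rintro ⟨a, c⟩ ⟨b, d⟩ h
      have h₁ : res (c : Aut S) (a : G)⁻¹ = res (d : Aut S) (b : G)⁻¹ :=
        Subtype.ext_iff.1 (congrArg Prod.fst h)
      have h₂ : (c : Aut S) (a : G)⁻¹ = (d : Aut S) (b : G)⁻¹ :=
        inv_injective (Subtype.ext_iff.1 (congrArg Prod.snd h))
      -- The output `r` of `(a, c)` sends `a` to the next state, so the output and next state
      -- determine `a`, and then `c`.
      have key : ∀ (a : letters S) (c : Q),
          res (c : Aut S) (a : G)⁻¹ a = ((c : Aut S) (a : G)⁻¹)⁻¹ := fun a c => by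
        rw [res_apply, inv_mul_cancel, hQ.apply_one c c.2, mul_one]
      have hab : a = b := by
        refine Subtype.ext ((res (c : Aut S) (a : G)⁻¹).injective ?_)
        rw [key, h₁, key, h₂]
      subst hab
      exact Prod.ext rfl (Subtype.ext
        (res_injective (hQ.apply_one c c.2) (hQ.apply_one d d.2) h₁))
    exact hinj.bijective_of_nat_card_le (by simp [Nat.card_prod, mul_comm])

theorem isBireversibleGroup_quotient_ker_wordAction (hS : S.Finite)
    (hgen : Subgroup.closure S = ⊤) {Q : Set (Aut S)} (hQ : IsSelfSimilar Q) (hfin : Q.Finite) :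
    IsBireversibleGroup (G ⧸ (wordAction hQ).ker) := by
  have := hfin.to_subtype
  have := (finite_letters hS).to_subtype
  refine (bireversible_letterAutomaton hS hQ hfin).isBireversibleGroup_quotient_ker _
    (fun a => (a : G)) ?_ fun a w => (act_letterAutomaton hQ a w).symm
  rw [Subtype.range_coe, closure_letters hgen]

/-! ### Infinite quotients -/

/-- If the group generated by `Q` is infinite, so is the quotient of `G` by the kernel of its action
on words over `Q`. -/
theorem infinite_quotient_ker_wordAction (hS : S.Finite) (hgen : Subgroup.closure S = ⊤)
    {Q : Set (Aut S)} (hQ : IsSelfSimilar Q) (hinf : Infinite (Subgroup.closure Q)) :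
    Infinite (G ⧸ (wordAction hQ).ker) := by
  by_contra hfin
  rw [not_infinite_iff_finite] at hfin
  have := (finite_letters hS).to_subtype
  -- `F c` records how the restrictions of `c` act on the neighbours of `1`. These depend only on
  -- the class modulo the kernel and determine `c` along paths from `1`, so a finite quotient would
  -- leave finitely many `c`.
  let F : Subgroup.closure Q → (G ⧸ (wordAction hQ).ker) × letters S → letters S :=
    fun c p => ⟨res (c : Aut S) p.1.out p.2, apply_mem_letters (res_apply_one _ _) p.2.2⟩
  have hout : ∀ (c : Subgroup.closure Q) (g : G),
      res (c : Aut S) (g : G ⧸ (wordAction hQ).ker).out = res (c : Aut S) g := by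
    intro c g
    obtain ⟨n, hn⟩ := QuotientGroup.mk_out_eq_mul (wordAction hQ).ker g
    have hn' := (inferInstance : (wordAction hQ).ker.Normal).conj_mem n n.2 g
    rw [hn, show g * (n : G) = g * n * g⁻¹ * g by group, res_mul,
      (mem_ker_wordAction hQ).1 hn' c c.2]
  have hF : Function.Injective F := by
    intro c d hcd
    have hstep : ∀ g, ∀ a ∈ letters S, res (c : Aut S) g a = res (d : Aut S) g a := by
      intro g a ha
      have := Subtype.ext_iff.1 (congrFun hcd ((g : G ⧸ (wordAction hQ).ker), ⟨a, ha⟩))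
      simpa only [F, hout] using this
    refine Subtype.ext (RelIso.ext fun g => ?_)
    have hg : g ∈ Subgroup.closure (letters S) := closure_letters hgen ▸ Subgroup.mem_top g
    induction hg using Subgroup.closure_induction_right with
    | one =>
      rw [apply_one_of_mem_closure hQ c.2, apply_one_of_mem_closure hQ d.2]
    | mul_right g _ a ha ih => rw [apply_mul, apply_mul, ih, hstep g a ha]
    | mul_inv_cancel g _ a ha ih =>
      rw [apply_mul, apply_mul, ih, hstep g _ (inv_mem_letters ha)]
  exact hinf.not_finite (Finite.of_injective F hF)

/-! ### Kernels and the largest normalised subgroup -/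

theorem conj_mem_map_largestNormalised {c : Aut S} (hc : c ∈ comm S) {g : G}
    (hg : g ∈ largestNormalised S) :
    c * leftMul S g * c⁻¹ ∈ (largestNormalised S).map (leftMul S) :=
  (Subgroup.mem_normalizer_iff.1 ((isGreatest_largestNormalised S).1 hc) _).1
    (Subgroup.mem_map_of_mem _ hg)

theorem largestNormalised_le_ker_wordAction {Q : Set (Aut S)} (hQ : IsSelfSimilar Q)
    (hQc : Q ⊆ commStab S) : largestNormalised S ≤ (wordAction hQ).ker := by
  intro g hg
  refine (mem_ker_wordAction hQ).2 fun c hc => ?_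
  rw [res_eq_self_iff (apply_one_of_mem_closure hQ hc)]
  have hc' : c ∈ commStab S := (Subgroup.closure_le _).2 hQc hc
  exact Subgroup.map_le_range _ _ (conj_mem_map_largestNormalised hc'.1 hg)

theorem isSelfSimilar_commStab : IsSelfSimilar (commStab S : Set (Aut S)) where
  apply_one _ hc := hc.2
  res_mem _ hc g := res_mem_commStab hc.1 g
  inv_mem _ hc := inv_mem hc

/-- A commensurating `c` is `leftMul S (c 1) * d` with `d` in the stabiliser. Conjugation by `d`
sends each `g` in the kernel to `d g`, again in the kernel, and the kernel is normal in `G`. -/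
theorem isNormalisedByComm_ker_wordAction_commStab :
    IsNormalisedByComm S (wordAction (isSelfSimilar_commStab (S := S))).ker := by
  set N := (wordAction (isSelfSimilar_commStab (S := S))).ker with hN
  have hker : ∀ g, g ∈ N ↔ ∀ c ∈ commStab S, res c g = c := fun g => by
    rw [hN, mem_ker_wordAction, Subgroup.closure_eq]
  have hconj : ∀ c ∈ comm S, ∀ g ∈ N, c * leftMul S g * c⁻¹ ∈ N.map (leftMul S) := by
    intro c hc g hg
    let d := (leftMul S (c 1))⁻¹ * c
    have hd : d ∈ commStab S :=
      mem_commStab.2 ⟨mul_mem (inv_mem (leftMul_mem_comm _)) hc, by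
        simp only [d]
        rw [← map_inv, mul_apply, leftMul_apply, inv_mul_cancel]⟩
    have hdg : res d g = d := (hker g).1 hg d hd
    have hdN : d g ∈ N := (hker _).2 fun e he => by
      have := (hker g).1 hg _ (mul_mem he hd)
      rwa [mul_res, hdg, mul_left_inj] at this
    have hdconj : d * leftMul S g * d⁻¹ = leftMul S (d g) := by
      nth_rw 2 [← hdg]
      simp [res, mul_assoc]
    refine ⟨c 1 * d g * (c 1)⁻¹, (MonoidHom.normal_ker _).conj_mem _ hdN _, ?_⟩
    rw [map_mul, map_mul, map_inv, ← hdconj]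
    simp only [d]
    group
  intro c hc
  refine Subgroup.mem_normalizer_iff.2 fun x => ⟨?_, fun hx => ?_⟩
  · rintro ⟨g, hg, rfl⟩
    exact hconj c hc g hg
  · obtain ⟨g, hg, hgx⟩ := hx
    have := hconj c⁻¹ (inv_mem hc) g hg
    rwa [hgx, show c⁻¹ * (c * x * c⁻¹) * c⁻¹⁻¹ = x by group] at this

/-- An element outside the largest subgroup normalised by the commensurator is detected by a single
element of the vertex stabiliser. -/
theorem exists_res_ne_of_notMem {g : G} (hg : g ∉ largestNormalised S) :
    ∃ c ∈ commStab S, res c g ≠ c := by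
  by_contra! h
  refine hg ((isGreatest_largestNormalised S).2 isNormalisedByComm_ker_wordAction_commStab ?_)
  rw [mem_ker_wordAction, Subgroup.closure_eq]
  exact h

theorem countable_of_closure_eq_top (hS : S.Finite) (hgen : Subgroup.closure S = ⊤) :
    Countable G := by
  have := hS.countable.to_subtype
  refine Function.Surjective.countable (f := FreeGroup.lift ((↑) : S → G)) ?_
  rw [← MonoidHom.range_eq_top, FreeGroup.range_lift_eq_closure, Subtype.range_coe, hgen]

end CayleyGraph

/-! ### Construction of the sequence -/

open CayleyGraph in
theorem theoremA {G : Type*} [Group G] (S : Set G) (hS : S.Finite)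
    (hgen : Subgroup.closure S = ⊤)
    (hcomm : ¬ IsLocallyFiniteGroup (CayleyGraph.commStab S)) :
    (∀ g : G, g ∉ CayleyGraph.largestNormalised S →
      ∃ (N : Subgroup G) (_ : N.Normal),
        CayleyGraph.largestNormalised S ≤ N ∧ g ∉ N ∧
          Infinite (G ⧸ N) ∧ IsBireversibleGroup (G ⧸ N)) ∧
    ∃ (N : ℕ → Subgroup G) (_ : ∀ i, (N i).Normal),
      Antitone N ∧ ⨅ i, N i = CayleyGraph.largestNormalised S ∧
        ∀ i, Infinite (G ⧸ N i) ∧ IsBireversibleGroup (G ⧸ N i) := by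
  have seq : ∃ (N : ℕ → Subgroup G) (_ : ∀ i, (N i).Normal),
      Antitone N ∧ ⨅ i, N i = largestNormalised S ∧
        ∀ i, Infinite (G ⧸ N i) ∧ IsBireversibleGroup (G ⧸ N i) := by
    obtain ⟨K, ⟨T, rfl⟩, hK⟩ :
        ∃ K : Subgroup (commStab S), K.FG ∧ ¬ Finite K := by
      simpa [IsLocallyFiniteGroup] using hcomm
    have := countable_of_closure_eq_top hS hgen
    obtain ⟨e, he⟩ := exists_surjective_nat G
    have hex : ∀ g : G, ∃ c ∈ commStab S, g ∉ largestNormalised S → res c g ≠ c := fun g => by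
      by_cases hg : g ∈ largestNormalised S
      · exact ⟨1, one_mem _, fun h => absurd hg h⟩
      · obtain ⟨c, hc, h⟩ := exists_res_ne_of_notMem hg
        exact ⟨c, hc, fun _ => h⟩
    choose t ht htne using hex
    -- `T` makes every quotient infinite; the `t (e j)` exclude, one at a time, the elements outside
    -- `D_G` from the intersection.
    let T' : ℕ → Set (Aut S) := fun i => Subtype.val '' (T : Set (commStab S)) ∪
      (fun j => t (e j)) '' Set.Iic i
    have hT'mono : Monotone T' := fun i j hij =>
      Set.union_subset_union_right _ (Set.image_mono (Set.Iic_subset_Iic.2 hij))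
    have hT'fin : ∀ i, (T' i).Finite := fun i =>
      (T.finite_toSet.image _).union ((Set.finite_Iic i).image _)
    have hT'c : ∀ i, T' i ⊆ commStab S := by
      rintro i _ (⟨c, -, rfl⟩ | ⟨j, -, rfl⟩)
      · exact c.2
      · exact ht _
    have hQ := fun i => isSelfSimilar_selfSimilarHull (T' i)
    refine ⟨fun i => (wordAction (hQ i)).ker, fun i => inferInstance, fun i j hij =>
      ker_wordAction_anti _ _ (selfSimilarHull_mono (hT'mono hij)), le_antisymm ?_ ?_,
      fun i => ⟨infinite_quotient_ker_wordAction hS hgen _ ?_,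
        isBireversibleGroup_quotient_ker_wordAction hS hgen _
          (finite_selfSimilarHull (hT'fin i) (hT'c i))⟩⟩
    · intro g hg
      by_contra hgD
      obtain ⟨i, rfl⟩ := he g
      refine htne _ hgD ((mem_ker_wordAction (hQ i)).1 (Subgroup.mem_iInf.1 hg i) _
        (Subgroup.subset_closure (subset_selfSimilarHull (hT'c i) (Or.inr ⟨i, ?_, rfl⟩))))
      exact Set.mem_Iic.2 le_rfl
    · exact le_iInf fun i =>
        largestNormalised_le_ker_wordAction _ (selfSimilarHull_subset (hT'c i))
    · have hle : (Subgroup.closure (T : Set (commStab S))).map (commStab S).subtype ≤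
          Subgroup.closure (selfSimilarHull (T' i)) := by
        rw [MonoidHom.map_closure]
        exact Subgroup.closure_mono
          (Set.subset_union_left.trans (subset_selfSimilarHull (hT'c i)))
      rw [← not_finite_iff_infinite]
      intro hfin
      refine hK (Finite.of_injective
        (fun k : Subgroup.closure (T : Set (commStab S)) =>
          (⟨((k : commStab S) : Aut S), hle ⟨k, k.2, rfl⟩⟩ :
            Subgroup.closure (selfSimilarHull (T' i)))) ?_)
      intro k l hkl
      exact Subtype.ext (Subtype.ext (congrArg Subtype.val hkl :))
  refine ⟨fun g hg => ?_, seq⟩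
  obtain ⟨N, hN, -, hinf, h⟩ := seq
  rw [← hinf, Subgroup.mem_iInf, not_forall] at hg
  obtain ⟨i, hi⟩ := hg
  exact ⟨N i, hN i, hinf ▸ iInf_le N i, hi, h i⟩
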